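/- Let $0\le\theta_L<\theta_H<\infty$. Let $F$ be an atomless probability distribution with support $[\theta_L,\theta_H]$ (for instance one with a positive density; $[\theta_L,\theta_H]=[0,1]$ is a normalization), with mean $\mu=\mathbb{E}_F[\theta]$. Let $J\ge 1$ be the number of sellers, and let $F^J$ be the distribution of the highest of $J$ independent draws from $F$. Fix the platform size $\lambda\in(0,1]$ and an off-platform quality $\hat q>0$; if $J=1$, assume also $2\hat q\le\theta_H-\theta_L$. Off-platform consumers have no private information, so the off-platform product is sold at price $\mu\hat q$ and the production cost of quality $q$ is $q^2/2$. A consumer on the platform with posterior mean $\theta$ obtains the rent $\max\{0,(\theta-\mu)\hat q\}$. The platform chooses a distribution $\hat F$ of posterior means on $[\theta_L,\theta_H]$ to solve $$\max_{\hat F}\;(1-\lambda)\Big(\mu\hat q-\frac{\hat q^2}{2}\Big)+\lambda\int_{\theta_L}^{\theta_H}\Big(\frac{\theta^2}{2}-\max\{0,(\theta-\mu)\hat q\}\Big)\,d\hat F(\theta)$$ subject to $F^J$ being a mean-preserving spread of $\hat F$, that is, $\int_v^{\theta_H}F^J(t)\,dt\le\int_v^{\theta_H}\hat F(t)\,dt$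 for all $v\in[\theta_L,\theta_H]$, with equality at $v=\theta_L$. Then there exist two real thresholds $x_1\le\mu\le x_2$ such that: 1. The problem has exactly one solution $\hat F^*$. Its distribution function coincides with $F^J$ on $(-\infty,x_1]$ and on $[x_2,\infty)$ (in particular on $[\theta_L,x_1]$, which is empty if $x_1<\theta_L$, and on $[x_2,\theta_H]$), and it has an atom at $\mu$, of mass $F^J(x_2)-F^J(x_1)>0$. 2. The pair $(x_1,x_2)$ is the unique solution in $\mathbb{R}^2$ of $$x_1+2\hat q=x_2,\qquad \mathbb{E}_{F^J}[\theta\mid x_1\le\theta\le x_2]=\mu.$$ -/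

import Mathlib

open MeasureTheory ProbabilityTheory Set

namespace ManagedCampaign

/-- The distribution function `F ^ J` (`J` independent draws from `P`, keep the highest), where
`F` is the distribution function of `P`. -/
noncomputable def powStieltjes (P : Measure ℝ) (J : ℕ) : StieltjesFunction ℝ where
  toFun x := cdf P x ^ J
  mono' _ _ h := pow_le_pow_left₀ (cdf_nonneg P _) (monotone_cdf P h) J
  right_continuous' x := ((cdf P).right_continuous x).pow J

/-- The probability law on `ℝ` whose distribution function is `F ^ J`. -/
noncomputable def highestValueLaw (P : Measure ℝ) (J : ℕ) : Measure ℝ :=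
  (powStieltjes P J).measure

/-- For distributions on `[θL, θH]` with distribution functions `F` and `G`:
`F` is a mean-preserving spread of `G`. -/
def IsMeanPreservingSpread (θL θH : ℝ) (F G : ℝ → ℝ) : Prop :=
  (∀ v ∈ Icc θL θH, ∫ t in v..θH, F t ≤ ∫ t in v..θH, G t) ∧
    ∫ t in θL..θH, F t = ∫ t in θL..θH, G t

/-- The prior mean of a consumer's value for any one seller; consumers without private
information all hold this expectation off the platform. -/
noncomputable def priorMean (P : Measure ℝ) : ℝ := ∫ θ, θ ∂P

/-- The off-platform price of the single product of quality `qhat`: it extracts the whole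
expected willingness to pay of a consumer with expectation `μ`. -/
def offPrice (μ qhat : ℝ) : ℝ := μ * qhat

/-- The rent of an on-platform consumer with posterior mean `θ`: the better of not buying and
buying the off-platform product. -/
noncomputable def rent (μ qhat θ : ℝ) : ℝ := max 0 (θ * qhat - offPrice μ qhat)

/-- The sponsored seller's on-platform profit from a consumer with posterior mean `θ`: the
efficient surplus (production cost `q ^ 2 / 2`) net of the rent. -/
noncomputable def onProfit (μ qhat θ : ℝ) : ℝ := θ ^ 2 / 2 - rent μ qhat θ

/-- The platform's objective, for platform size `lam`, off-platform quality `qhat` and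
distribution `Q` of posterior means for the sponsored product. -/
noncomputable def objective (θL θH μ lam qhat : ℝ) (Q : Measure ℝ) : ℝ :=
  (1 - lam) * (offPrice μ qhat - qhat ^ 2 / 2)
    + lam * ∫ θ in Icc θL θH, onProfit μ qhat θ ∂Q

/-- `Q` is an admissible distribution of posterior means: a probability law on `[θL, θH]` of
which `F ^ J` is a mean-preserving spread. -/
def Feasible (θL θH : ℝ) (J : ℕ) (P Q : Measure ℝ) : Prop :=
  IsProbabilityMeasure Q ∧ (∀ᵐ θ ∂Q, θ ∈ Icc θL θH) ∧
    IsMeanPreservingSpread θL θH (powStieltjes P J) (cdf Q)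

/-- `Q` solves the platform's information design problem with `qhat` held fixed. -/
def IsOptimalDesign (θL θH : ℝ) (J : ℕ) (P : Measure ℝ) (lam qhat : ℝ) (Q : Measure ℝ) : Prop :=
  Feasible θL θH J P Q ∧ ∀ R : Measure ℝ, Feasible θL θH J P R →
    objective θL θH (priorMean P) lam qhat R ≤ objective θL θH (priorMean P) lam qhat Q

/-- The two equations for the thresholds:
`x₁ + 2 * qhat = x₂` and `E[θ | x₁ ≤ θ ≤ x₂] = μ`, the expectation being under `F ^ J`. -/
def ThresholdEquations (J : ℕ) (P : Measure ℝ) (qhat x₁ x₂ : ℝ) : Prop :=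
  x₁ + 2 * qhat = x₂ ∧ ∫ θ, θ ∂(cond (highestValueLaw P J) (Icc x₁ x₂)) = priorMean P

end ManagedCampaign

/-!
The proof is a duality argument. The on-platform profit is dominated by a convex function, the
shadow price, which agrees with it off the pooling interval `[x₁, x₂]` and at the mean `μ`. The
profit is quadratic with slopes `θ` below `μ` and `θ - q` above it, so the secant joining the two
branches at `x₁` and `x₂` meets the profit at `μ` exactly when `x₂ - x₁ = 2 * q`; this is the first
threshold equation. Convexity bounds the value of any feasible design by the integral of the shadow
price under `F ^ J`. Pooling `[x₁, x₂]` at `μ` attains the bound because the shadow price is affine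
there, and it is feasible by the second threshold equation.

For uniqueness, the shadow price is an affine function plus a mixture of calls struck above `x₂` and
puts struck below `x₁`. An optimal design prices all of them as `F ^ J` does, so its stop-loss
transform, hence its mass on rays, agrees with that of `F ^ J` outside `(x₁, x₂)`, while inside it
can only charge `μ`. Reflecting `θ ↦ -θ` turns puts into calls.

The thresholds exist by the intermediate value theorem. Were there two pairs, then what the interval
loses on the left and gains on the right when shifted from one to the other would be null, so both
intervals would contain the support. This forces `μ` to be the mean of `F ^ J`, hence `J = 1`, and
then `2 * q ≤ θH - θL` leaves no room for a shift.
-/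

namespace ManagedCampaign

open Filter Topology

theorem integrable_of_continuous {ν : Measure ℝ} [IsFiniteMeasure ν] {L H : ℝ}
    (hν : ∀ᵐ θ ∂ν, θ ∈ Icc L H) {φ : ℝ → ℝ} (hφ : Continuous φ) : Integrable φ ν := by
  obtain ⟨C, hC⟩ := isCompact_Icc.exists_bound_of_continuousOn (hφ.continuousOn (s := Icc L H))
  exact .of_bound hφ.aestronglyMeasurable C (hν.mono hC)

/-- The stop-loss transform `t ↦ E[(θ - t)⁺]` of the law `ν`: the expected payoff of a call option
with strike `t`. -/
noncomputable def stopLoss (ν : Measure ℝ) (t : ℝ) : ℝ := ∫ θ, max (θ - t) 0 ∂ν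

section StopLoss

variable {ν : Measure ℝ}

theorem stopLoss_eq_zero {t : ℝ} (hν : ∀ᵐ θ ∂ν, θ ≤ t) : stopLoss ν t = 0 :=
  integral_eq_zero_of_ae (hν.mono fun _ hθ ↦ max_eq_right (sub_nonpos.2 hθ))

theorem integrable_max_sub [IsFiniteMeasure ν] (hν : Integrable (fun θ ↦ θ) ν) (t : ℝ) :
    Integrable (fun θ ↦ max (θ - t) 0) ν :=
  (hν.sub (integrable_const t)).pos_part

theorem intervalIntegrable_one_sub_cdf (s t : ℝ) :
    IntervalIntegrable (fun u ↦ 1 - cdf ν u) volume s t :=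
  intervalIntegrable_const.sub (monotone_cdf ν).intervalIntegrable

variable [IsProbabilityMeasure ν]

theorem stopLoss_eq_mean_sub (hν : Integrable (fun θ ↦ θ) ν) {t : ℝ} (ht : ∀ᵐ θ ∂ν, t ≤ θ) :
    stopLoss ν t = ∫ θ, θ ∂ν - t := by
  rw [stopLoss, integral_congr_ae (ht.mono fun θ hθ ↦ max_eq_left (sub_nonneg.2 hθ)),
    integral_sub hν (integrable_const t)]
  simp

theorem stopLoss_map_neg (hν : Integrable (fun θ ↦ θ) ν) (t : ℝ) :
    stopLoss (ν.map Neg.neg) (-t) = stopLoss ν t + t - ∫ θ, θ ∂ν := by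
  have h (θ : ℝ) : max (-θ - -t) 0 = max (θ - t) 0 + t - θ := by grind
  have h_max := integrable_max_sub hν t
  rw [stopLoss, integral_map measurable_neg.aemeasurable (by fun_prop), stopLoss]
  simp_rw [h]
  rw [integral_sub (by fun_prop) hν, integral_add (by fun_prop) (by fun_prop)]
  simp

theorem measureReal_Ioi_eq_one_sub_cdf (t : ℝ) : ν.real (Ioi t) = 1 - cdf ν t := by
  rw [cdf_eq_real, ← compl_Iic, probReal_compl_eq_one_sub measurableSet_Iic]

theorem integral_indicator_Iio {s t : ℝ} (hst : s ≤ t) (θ : ℝ) :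
    ∫ u in s..t, (Iio θ).indicator 1 u = max (θ - s) 0 - max (θ - t) 0 := by
  rw [intervalIntegral.integral_of_le hst, integral_Ioc_eq_integral_Ioo,
    setIntegral_indicator measurableSet_Iio, Ioo_inter_Iio]
  simp
  grind

theorem stopLoss_sub_stopLoss (hν : Integrable (fun θ ↦ θ) ν) {s t : ℝ} (hst : s ≤ t) :
    stopLoss ν s - stopLoss ν t = ∫ u in s..t, (1 - cdf ν u) := by
  have h_tail (u : ℝ) : 1 - cdf ν u = ∫ θ, (Iio θ).indicator (1 : ℝ → ℝ) u ∂ν := by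
    rw [← measureReal_Ioi_eq_one_sub_cdf, ← integral_indicator_one measurableSet_Ioi]
    rfl
  have h_meas : Measurable fun p : ℝ × ℝ ↦ (Iio p.2).indicator (1 : ℝ → ℝ) p.1 :=
    measurable_one.indicator (measurableSet_lt measurable_fst measurable_snd)
  have : IsFiniteMeasure (volume.restrict (uIoc s t)) :=
    ⟨by rw [Measure.restrict_apply_univ]; exact measure_Ioc_lt_top⟩
  simp_rw [h_tail]
  rw [intervalIntegral_integral_swap, stopLoss, stopLoss,
    ← integral_sub (integrable_max_sub hν s) (integrable_max_sub hν t)]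
  · simp_rw [integral_indicator_Iio hst]
  · refine .of_bound h_meas.aestronglyMeasurable 1 (.of_forall fun p ↦ ?_)
    simpa using! norm_indicator_le_norm_self (1 : ℝ → ℝ) p.1

theorem integral_cdf (hν : Integrable (fun θ ↦ θ) ν) {s t : ℝ} (hst : s ≤ t) :
    ∫ u in s..t, cdf ν u = t - s - (stopLoss ν s - stopLoss ν t) := by
  rw [stopLoss_sub_stopLoss hν hst, intervalIntegral.integral_sub intervalIntegrable_const
    (monotone_cdf ν).intervalIntegrable]
  simp

theorem continuous_stopLoss (hν : Integrable (fun θ ↦ θ) ν) : Continuous (stopLoss ν) := by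
  have h (t : ℝ) : stopLoss ν t = stopLoss ν 0 - ∫ u in (0 : ℝ)..t, (1 - cdf ν u) := by
    rcases le_total 0 t with ht | ht
    · linarith [stopLoss_sub_stopLoss hν ht]
    · rw [intervalIntegral.integral_symm]
      linarith [stopLoss_sub_stopLoss hν ht]
  rw [funext h]
  exact continuous_const.sub
    (intervalIntegral.continuous_primitive intervalIntegrable_one_sub_cdf 0)

theorem mul_one_sub_cdf_le_stopLoss_sub (hν : Integrable (fun θ ↦ θ) ν) {s t : ℝ} (hst : s ≤ t) :
    (t - s) * (1 - cdf ν t) ≤ stopLoss ν s - stopLoss ν t := by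
  rw [stopLoss_sub_stopLoss hν hst, ← smul_eq_mul, ← intervalIntegral.integral_const]
  exact intervalIntegral.integral_mono_on hst intervalIntegrable_const
    (intervalIntegrable_one_sub_cdf s t) fun u hu ↦ sub_le_sub_left (monotone_cdf ν hu.2) 1

theorem stopLoss_sub_le_mul_one_sub_cdf (hν : Integrable (fun θ ↦ θ) ν) {s t : ℝ} (hst : s ≤ t) :
    stopLoss ν s - stopLoss ν t ≤ (t - s) * (1 - cdf ν s) := by
  rw [stopLoss_sub_stopLoss hν hst, ← smul_eq_mul, ← intervalIntegral.integral_const]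
  exact intervalIntegral.integral_mono_on hst (intervalIntegrable_one_sub_cdf s t)
    intervalIntegrable_const fun u hu ↦ sub_le_sub_left (monotone_cdf ν hu.1) 1

theorem integral_max_zero (a b : ℝ) :
    ∫ u in a..b, max u 0 = max b 0 ^ 2 / 2 - max a 0 ^ 2 / 2 := by
  have h_int (a b : ℝ) : IntervalIntegrable (fun u : ℝ ↦ max u 0) volume a b :=
    (continuous_id.max continuous_const).intervalIntegrable a b
  have h (c : ℝ) : ∫ u in (0 : ℝ)..c, max u 0 = max c 0 ^ 2 / 2 := by
    rcases le_total 0 c with hc | hc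
    · rw [intervalIntegral.integral_congr (g := fun u ↦ u) fun u hu ↦ ?_, integral_id,
        max_eq_left hc]
      · ring
      · exact max_eq_left (uIcc_of_le hc ▸ hu).1
    · rw [intervalIntegral.integral_congr (g := fun _ ↦ 0) fun u hu ↦ ?_, max_eq_right hc]
      · simp
      · exact max_eq_right (uIcc_of_ge hc ▸ hu).2
  rw [← h, ← h, intervalIntegral.integral_interval_sub_left (h_int 0 b) (h_int 0 a)]

theorem integral_stopLoss (hν : Integrable (fun θ ↦ θ) ν) {c b : ℝ} (hb : ∀ᵐ θ ∂ν, θ ≤ b) :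
    ∫ t in c..b, stopLoss ν t = ∫ θ, max (θ - c) 0 ^ 2 / 2 ∂ν := by
  have : IsFiniteMeasure (volume.restrict (uIoc c b)) :=
    ⟨by rw [Measure.restrict_apply_univ]; exact measure_Ioc_lt_top⟩
  have h_id : Integrable (fun t : ℝ ↦ t) (volume.restrict (uIoc c b)) :=
    intervalIntegrable_iff.1 (continuous_id'.intervalIntegrable c b)
  unfold stopLoss
  rw [intervalIntegral_integral_swap ((hν.comp_snd _).sub (h_id.comp_fst ν)).pos_part]
  refine integral_congr_ae (hb.mono fun θ hθ ↦ ?_)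
  simp only [intervalIntegral.integral_comp_sub_left (fun u ↦ max u 0) θ, integral_max_zero,
    max_eq_right (sub_nonpos.2 hθ)]
  simp

end StopLoss

/-- The convex order on laws on `ℝ` with finite mean, encoded as equality of the means and
domination of the stop-loss transforms. -/
structure ConvexLE (ρ ν : Measure ℝ) : Prop where
  mean_eq : ∫ θ, θ ∂ρ = ∫ θ, θ ∂ν
  stopLoss_le : ∀ t, stopLoss ρ t ≤ stopLoss ν t

section ConvexOrder

variable {ρ ν : Measure ℝ} [IsProbabilityMeasure ρ] [IsProbabilityMeasure ν]

theorem isMeanPreservingSpread_cdf_iff {L H : ℝ} (hLH : L ≤ H) (hρ : ∀ᵐ θ ∂ρ, θ ∈ Icc L H)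
    (hν : ∀ᵐ θ ∂ν, θ ∈ Icc L H) :
    IsMeanPreservingSpread L H (cdf ν) (cdf ρ) ↔ ConvexLE ρ ν := by
  have hρ' : Integrable (fun θ ↦ θ) ρ := integrable_of_continuous hρ continuous_id
  have hν' : Integrable (fun θ ↦ θ) ν := integrable_of_continuous hν continuous_id
  have hρ₀ {t : ℝ} (ht : H ≤ t) := stopLoss_eq_zero (hρ.mono fun _ hθ ↦ hθ.2.trans ht)
  have hν₀ {t : ℝ} (ht : H ≤ t) := stopLoss_eq_zero (hν.mono fun _ hθ ↦ hθ.2.trans ht)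
  have hρ₁ {t : ℝ} (ht : t ≤ L) := stopLoss_eq_mean_sub hρ' (hρ.mono fun _ hθ ↦ ht.trans hθ.1)
  have hν₁ {t : ℝ} (ht : t ≤ L) := stopLoss_eq_mean_sub hν' (hν.mono fun _ hθ ↦ ht.trans hθ.1)
  have h_le {v : ℝ} (hv : v ≤ H) :
      ∫ t in v..H, cdf ν t ≤ ∫ t in v..H, cdf ρ t ↔ stopLoss ρ v ≤ stopLoss ν v := by
    rw [integral_cdf hρ' hv, integral_cdf hν' hv, hρ₀ le_rfl, hν₀ le_rfl]
    constructor <;> intro <;> linarith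
  have h_eq : ∫ t in L..H, cdf ν t = ∫ t in L..H, cdf ρ t ↔ ∫ θ, θ ∂ρ = ∫ θ, θ ∂ν := by
    rw [integral_cdf hρ' hLH, integral_cdf hν' hLH, hρ₀ le_rfl, hν₀ le_rfl, hρ₁ le_rfl,
      hν₁ le_rfl]
    constructor <;> intro <;> linarith
  refine ⟨fun h ↦ ⟨h_eq.1 h.2, fun t ↦ ?_⟩,
    fun h ↦ ⟨fun v hv ↦ (h_le hv.2).2 (h.stopLoss_le v), h_eq.2 h.mean_eq⟩⟩
  rcases le_total t L with hL | hL
  · rw [hρ₁ hL, hν₁ hL, h_eq.1 h.2]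
  rcases le_total H t with hH | hH
  · rw [hρ₀ hH, hν₀ hH]
  · exact (h_le hH).1 (h.1 t ⟨hL, hH⟩)

namespace ConvexLE

theorem map_neg (h : ConvexLE ρ ν) (hρ : Integrable (fun θ ↦ θ) ρ)
    (hν : Integrable (fun θ ↦ θ) ν) : ConvexLE (ρ.map Neg.neg) (ν.map Neg.neg) where
  mean_eq := by
    rw [integral_map measurable_neg.aemeasurable (by fun_prop),
      integral_map measurable_neg.aemeasurable (by fun_prop), integral_neg, integral_neg,
      h.mean_eq]
  stopLoss_le t := by
    rw [← neg_neg t, stopLoss_map_neg hρ, stopLoss_map_neg hν, h.mean_eq]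
    gcongr
    exact h.stopLoss_le _

theorem measureReal_Iic_le_of_stopLoss_eq (h : ConvexLE ρ ν) (hρ : Integrable (fun θ ↦ θ) ρ)
    (hν : Integrable (fun θ ↦ θ) ν) {v : ℝ} (hv : stopLoss ρ v = stopLoss ν v) :
    ρ.real (Iic v) ≤ ν.real (Iic v) := by
  rw [← cdf_eq_real, ← cdf_eq_real]
  have h_tendsto : Tendsto (cdf ν) (𝓝[>] v) (𝓝 (cdf ν v)) :=
    ((cdf ν).right_continuous v).mono_left (nhdsWithin_mono v Ioi_subset_Ici_self)
  refine ge_of_tendsto h_tendsto ?_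
  filter_upwards [self_mem_nhdsWithin] with t (ht : v < t)
  have h_slope : (t - v) * (1 - cdf ν t) ≤ (t - v) * (1 - cdf ρ v) := by
    linarith [mul_one_sub_cdf_le_stopLoss_sub hν ht.le, h.stopLoss_le t,
      stopLoss_sub_le_mul_one_sub_cdf hρ ht.le]
  linarith [le_of_mul_le_mul_left h_slope (sub_pos.2 ht)]

theorem measureReal_Ici_le_of_stopLoss_eq (h : ConvexLE ρ ν) (hρ : Integrable (fun θ ↦ θ) ρ)
    (hν : Integrable (fun θ ↦ θ) ν) {v : ℝ} (hv : stopLoss ρ v = stopLoss ν v) :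
    ρ.real (Ici v) ≤ ν.real (Ici v) := by
  have := Measure.isProbabilityMeasure_map (μ := ρ) measurable_neg.aemeasurable
  have := Measure.isProbabilityMeasure_map (μ := ν) measurable_neg.aemeasurable
  have h_neg := (h.map_neg hρ hν).measureReal_Iic_le_of_stopLoss_eq (v := -v)
    ((integrable_map_measure (by fun_prop) measurable_neg.aemeasurable).2 hρ.neg)
    ((integrable_map_measure (by fun_prop) measurable_neg.aemeasurable).2 hν.neg)
    (by rw [stopLoss_map_neg hρ, stopLoss_map_neg hν, hv, h.mean_eq])
  simpa [map_measureReal_apply measurable_neg measurableSet_Iic] using h_neg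

theorem measureReal_rays_eq_of_stopLoss_eq [NullSingletonClass ν] (h : ConvexLE ρ ν)
    (hρ : Integrable (fun θ ↦ θ) ρ) (hν : Integrable (fun θ ↦ θ) ν) {v : ℝ}
    (hv : stopLoss ρ v = stopLoss ν v) :
    ρ.real (Iic v) = ν.real (Iic v) ∧ ρ.real (Ici v) = ν.real (Ici v) := by
  have h_Iic := h.measureReal_Iic_le_of_stopLoss_eq hρ hν hv
  have h_Ici := h.measureReal_Ici_le_of_stopLoss_eq hρ hν hv
  have h_one_le : 1 ≤ ρ.real (Iic v) + ρ.real (Ici v) := by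
    rw [← probReal_univ (μ := ρ), ← Iic_union_Ici (a := v)]
    exact measureReal_union_le _ _
  have h_eq_one : ν.real (Iic v) + ν.real (Ici v) = 1 := by
    rw [measureReal_congr Iio_ae_eq_Iic.symm, ← compl_Ici,
      probReal_compl_eq_one_sub measurableSet_Ici, sub_add_cancel]
  constructor <;> linarith

end ConvexLE

end ConvexOrder

/-- The convex function that is `0` for `s ≤ 0` and `k * s + s ^ 2 / 2` for `s ≥ 0`; shadow prices
are built from it. -/
noncomputable def ramp (k s : ℝ) : ℝ := k * max s 0 + max s 0 ^ 2 / 2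

@[fun_prop]
theorem continuous_ramp (k : ℝ) : Continuous (ramp k) := by
  unfold ramp; fun_prop

theorem ramp_of_nonpos (k : ℝ) {s : ℝ} (hs : s ≤ 0) : ramp k s = 0 := by
  simp [ramp, hs]

theorem ramp_of_nonneg (k : ℝ) {s : ℝ} (hs : 0 ≤ s) : ramp k s = k * s + s ^ 2 / 2 := by
  rw [ramp, max_eq_left hs]

theorem integral_ramp {ν : Measure ℝ} [IsProbabilityMeasure ν] {L H : ℝ}
    (hν : ∀ᵐ θ ∂ν, θ ∈ Icc L H) (k c : ℝ) :
    ∫ θ, ramp k (θ - c) ∂ν = k * stopLoss ν c + ∫ t in c..H, stopLoss ν t := by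
  have h_int {φ : ℝ → ℝ} (hφ : Continuous φ) : Integrable φ ν := integrable_of_continuous hν hφ
  rw [integral_stopLoss (h_int continuous_id) (hν.mono fun _ hθ ↦ hθ.2), stopLoss,
    ← integral_const_mul, ← integral_add (h_int (by fun_prop)) (h_int (by fun_prop))]
  rfl

namespace ConvexLE

variable {ρ ν : Measure ℝ} [IsProbabilityMeasure ρ] [IsProbabilityMeasure ν] {L H k c : ℝ}

theorem integral_ramp_le (h : ConvexLE ρ ν) (hρ : ∀ᵐ θ ∂ρ, θ ∈ Icc L H)
    (hν : ∀ᵐ θ ∂ν, θ ∈ Icc L H) (hk : 0 ≤ k) (c : ℝ) :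
    ∫ θ, ramp k (θ - c) ∂ρ ≤ ∫ θ, ramp k (θ - c) ∂ν := by
  have h_mono (a : ℝ) (ha : a ∈ Icc L H) : a ∈ Icc L (max H c) :=
    Icc_subset_Icc_right (le_max_left H c) ha
  rw [integral_ramp (hρ.mono h_mono), integral_ramp (hν.mono h_mono)]
  refine add_le_add (mul_le_mul_of_nonneg_left (h.stopLoss_le c) hk)
    (intervalIntegral.integral_mono_on (le_max_right H c) ?_ ?_ fun t _ ↦ h.stopLoss_le t)
  · exact (continuous_stopLoss (integrable_of_continuous hρ continuous_id)).intervalIntegrable _ _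
  · exact (continuous_stopLoss (integrable_of_continuous hν continuous_id)).intervalIntegrable _ _

theorem stopLoss_eq_of_integral_ramp_eq (h : ConvexLE ρ ν) (hρ : ∀ᵐ θ ∂ρ, θ ∈ Icc L H)
    (hν : ∀ᵐ θ ∂ν, θ ∈ Icc L H) (hk : 0 ≤ k)
    (h_eq : ∫ θ, ramp k (θ - c) ∂ρ = ∫ θ, ramp k (θ - c) ∂ν) {t : ℝ} (ht : c ≤ t) :
    stopLoss ρ t = stopLoss ν t := by
  rcases le_or_gt H t with hH | hH
  · rw [stopLoss_eq_zero (hρ.mono fun _ hθ ↦ hθ.2.trans hH),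
      stopLoss_eq_zero (hν.mono fun _ hθ ↦ hθ.2.trans hH)]
  by_contra h_ne
  have h_lt : ∫ t in c..H, stopLoss ρ t < ∫ t in c..H, stopLoss ν t :=
    intervalIntegral.integral_lt_integral_of_continuousOn_of_le_of_exists_lt (ht.trans_lt hH)
      (continuous_stopLoss (integrable_of_continuous hρ continuous_id)).continuousOn
      (continuous_stopLoss (integrable_of_continuous hν continuous_id)).continuousOn
      (fun u _ ↦ h.stopLoss_le u) ⟨t, ⟨ht, hH.le⟩, (h.stopLoss_le t).lt_of_ne h_ne⟩
  rw [integral_ramp hρ, integral_ramp hν] at h_eq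
  linarith [mul_le_mul_of_nonneg_left (h.stopLoss_le c) hk]

end ConvexLE

section Reflection

variable {ν : Measure ℝ} {L H : ℝ}

theorem ae_map_neg_mem_Icc (hν : ∀ᵐ θ ∂ν, θ ∈ Icc L H) :
    ∀ᵐ θ ∂ν.map Neg.neg, θ ∈ Icc (-H) (-L) :=
  (ae_map_iff measurable_neg.aemeasurable measurableSet_Icc).2
    (hν.mono fun _ hθ ↦ ⟨neg_le_neg hθ.2, neg_le_neg hθ.1⟩)

theorem integral_ramp_map_neg (k c : ℝ) :
    ∫ θ, ramp k (θ - -c) ∂ν.map Neg.neg = ∫ θ, ramp k (c - θ) ∂ν := by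
  rw [integral_map measurable_neg.aemeasurable
    (Continuous.aestronglyMeasurable (by fun_prop))]
  simp only [sub_neg_eq_add, neg_add_eq_sub]

end Reflection

namespace ConvexLE

variable {ρ ν : Measure ℝ} [IsProbabilityMeasure ρ] [IsProbabilityMeasure ν] {L H k c : ℝ}

theorem integral_ramp_sub_le (h : ConvexLE ρ ν) (hρ : ∀ᵐ θ ∂ρ, θ ∈ Icc L H)
    (hν : ∀ᵐ θ ∂ν, θ ∈ Icc L H) (hk : 0 ≤ k) (c : ℝ) :
    ∫ θ, ramp k (c - θ) ∂ρ ≤ ∫ θ, ramp k (c - θ) ∂ν := by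
  have := Measure.isProbabilityMeasure_map (μ := ρ) measurable_neg.aemeasurable
  have := Measure.isProbabilityMeasure_map (μ := ν) measurable_neg.aemeasurable
  have h_neg := h.map_neg (integrable_of_continuous hρ continuous_id)
    (integrable_of_continuous hν continuous_id)
  simpa only [integral_ramp_map_neg] using
    h_neg.integral_ramp_le (ae_map_neg_mem_Icc hρ) (ae_map_neg_mem_Icc hν) hk (-c)

theorem stopLoss_eq_of_integral_ramp_sub_eq (h : ConvexLE ρ ν) (hρ : ∀ᵐ θ ∂ρ, θ ∈ Icc L H)
    (hν : ∀ᵐ θ ∂ν, θ ∈ Icc L H) (hk : 0 ≤ k)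
    (h_eq : ∫ θ, ramp k (c - θ) ∂ρ = ∫ θ, ramp k (c - θ) ∂ν) {t : ℝ} (ht : t ≤ c) :
    stopLoss ρ t = stopLoss ν t := by
  have := Measure.isProbabilityMeasure_map (μ := ρ) measurable_neg.aemeasurable
  have := Measure.isProbabilityMeasure_map (μ := ν) measurable_neg.aemeasurable
  have hρ' := integrable_of_continuous hρ continuous_id
  have hν' := integrable_of_continuous hν continuous_id
  have h_neg := (h.map_neg hρ' hν').stopLoss_eq_of_integral_ramp_eq (ae_map_neg_mem_Icc hρ)
    (ae_map_neg_mem_Icc hν) hk (by simpa only [integral_ramp_map_neg] using h_eq) (neg_le_neg ht)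
  rw [stopLoss_map_neg hρ', stopLoss_map_neg hν', h.mean_eq] at h_neg
  linarith

end ConvexLE

/-- The shadow price of the information design problem for the pooling interval
`[x, x + 2 * q]` with pooled mean `m`: affine on that interval, quadratic on either side of it,
and equal to `onProfit m q` at `m` and outside the interval. -/
noncomputable def shadowPrice (m q x θ : ℝ) : ℝ :=
  x ^ 2 / 2 + (m + x) / 2 * (θ - x) + ramp ((m - x) / 2) (x - θ)
    + ramp ((x + 2 * q - m) / 2) (θ - (x + 2 * q))

theorem continuous_shadowPrice (m q x : ℝ) : Continuous (shadowPrice m q x) := by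
  unfold shadowPrice ramp; fun_prop

theorem continuous_onProfit (m q : ℝ) : Continuous (onProfit m q) := by
  unfold onProfit rent; fun_prop

section ShadowPrice

variable {m q x θ : ℝ}

theorem onProfit_of_le (hq : 0 ≤ q) (hθ : θ ≤ m) : onProfit m q θ = θ ^ 2 / 2 := by
  rw [onProfit, rent, offPrice, max_eq_left (by nlinarith), sub_zero]

theorem onProfit_of_ge (hq : 0 ≤ q) (hθ : m ≤ θ) : onProfit m q θ = θ ^ 2 / 2 - (θ - m) * q := by
  rw [onProfit, rent, offPrice, max_eq_right (by nlinarith), sub_mul]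

theorem shadowPrice_of_le (hq : 0 ≤ q) (hθ : θ ≤ x) : shadowPrice m q x θ = θ ^ 2 / 2 := by
  rw [shadowPrice, ramp_of_nonneg _ (by linarith), ramp_of_nonpos _ (by linarith)]
  ring

theorem shadowPrice_of_mem_Icc (hθ : θ ∈ Icc x (x + 2 * q)) :
    shadowPrice m q x θ = x ^ 2 / 2 + (m + x) / 2 * (θ - x) := by
  rw [shadowPrice, ramp_of_nonpos _ (by linarith [hθ.1]), ramp_of_nonpos _ (by linarith [hθ.2])]
  ring

theorem shadowPrice_of_ge (hq : 0 ≤ q) (hθ : x + 2 * q ≤ θ) :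
    shadowPrice m q x θ = θ ^ 2 / 2 - (θ - m) * q := by
  rw [shadowPrice, ramp_of_nonpos _ (by linarith), ramp_of_nonneg _ (by linarith)]
  ring

theorem onProfit_lt_shadowPrice (hθ : θ ∈ Ioo x (x + 2 * q)) (h_ne : θ ≠ m) :
    onProfit m q θ < shadowPrice m q x θ := by
  obtain ⟨h_left, h_right⟩ := hθ
  rw [shadowPrice_of_mem_Icc ⟨h_left.le, h_right.le⟩]
  rcases h_ne.lt_or_gt with h | h
  · rw [onProfit_of_le (by linarith) h.le]
    linarith [mul_pos (sub_pos.2 h_left) (sub_pos.2 h)]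
  · rw [onProfit_of_ge (by linarith) h.le]
    linarith [mul_pos (sub_pos.2 h_right) (sub_pos.2 h)]

theorem onProfit_eq_shadowPrice (hm : m ∈ Ioo x (x + 2 * q))
    (hθ : θ ∉ Ioo x (x + 2 * q) ∨ θ = m) : onProfit m q θ = shadowPrice m q x θ := by
  have hq : 0 ≤ q := by linarith [hm.1, hm.2]
  rcases hθ with hθ | rfl
  · rcases le_or_gt θ x with h | h
    · rw [onProfit_of_le hq (h.trans hm.1.le), shadowPrice_of_le hq h]
    · have h' : x + 2 * q ≤ θ := not_lt.1 fun h' ↦ hθ ⟨h, h'⟩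
      rw [onProfit_of_ge hq (hm.2.le.trans h'), shadowPrice_of_ge hq h']
  · rw [onProfit_of_le hq le_rfl, shadowPrice_of_mem_Icc ⟨hm.1.le, hm.2.le⟩]
    ring

theorem onProfit_le_shadowPrice (hm : m ∈ Ioo x (x + 2 * q)) (θ : ℝ) :
    onProfit m q θ ≤ shadowPrice m q x θ := by
  by_cases h : θ ∉ Ioo x (x + 2 * q) ∨ θ = m
  · exact (onProfit_eq_shadowPrice hm h).le
  · push Not at h
    exact (onProfit_lt_shadowPrice h.1 h.2).le

theorem integral_onProfit_le_integral_shadowPrice {ρ : Measure ℝ} [IsFiniteMeasure ρ] {L H : ℝ}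
    (hρ : ∀ᵐ θ ∂ρ, θ ∈ Icc L H) (hm : m ∈ Ioo x (x + 2 * q)) :
    ∫ θ, onProfit m q θ ∂ρ ≤ ∫ θ, shadowPrice m q x θ ∂ρ :=
  integral_mono (integrable_of_continuous hρ (continuous_onProfit m q))
    (integrable_of_continuous hρ (continuous_shadowPrice m q x)) (onProfit_le_shadowPrice hm)

theorem ae_notMem_Ioo_of_integral_shadowPrice_le {ρ : Measure ℝ} [IsFiniteMeasure ρ] {L H : ℝ}
    (hρ : ∀ᵐ θ ∂ρ, θ ∈ Icc L H) (hm : m ∈ Ioo x (x + 2 * q))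
    (h_le : ∫ θ, shadowPrice m q x θ ∂ρ ≤ ∫ θ, onProfit m q θ ∂ρ) :
    ∀ᵐ θ ∂ρ, θ ∉ Ioo x (x + 2 * q) ∨ θ = m := by
  have h_eq := (integral_eq_iff_of_ae_le
    (integrable_of_continuous hρ (continuous_onProfit m q))
    (integrable_of_continuous hρ (continuous_shadowPrice m q x))
    (.of_forall (onProfit_le_shadowPrice hm))).1
      ((integral_onProfit_le_integral_shadowPrice hρ hm).antisymm h_le)
  filter_upwards [h_eq] with θ hθ
  by_contra! h_mem
  exact (onProfit_lt_shadowPrice h_mem.1 h_mem.2).ne hθ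

theorem integral_shadowPrice {ν : Measure ℝ} [IsProbabilityMeasure ν] {L H : ℝ}
    (hν : ∀ᵐ θ ∂ν, θ ∈ Icc L H) (m q x : ℝ) :
    ∫ θ, shadowPrice m q x θ ∂ν = x ^ 2 / 2 + (m + x) / 2 * (∫ θ, θ ∂ν - x)
      + ∫ θ, ramp ((m - x) / 2) (x - θ) ∂ν
      + ∫ θ, ramp ((x + 2 * q - m) / 2) (θ - (x + 2 * q)) ∂ν := by
  have h_int {φ : ℝ → ℝ} (hφ : Continuous φ) : Integrable φ ν := integrable_of_continuous hν hφ
  unfold shadowPrice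
  rw [integral_add (h_int (by fun_prop)) (h_int (by fun_prop)),
    integral_add (h_int (by fun_prop)) (h_int (by fun_prop)),
    integral_add (integrable_const _) (h_int (by fun_prop)), integral_const_mul,
    integral_sub (h_int continuous_id') (integrable_const _)]
  simp

end ShadowPrice

section ConvexOrder

variable {ρ ν : Measure ℝ} [IsProbabilityMeasure ρ] [IsProbabilityMeasure ν] {L H m q x : ℝ}

theorem ConvexLE.integral_shadowPrice_le (h : ConvexLE ρ ν) (hρ : ∀ᵐ θ ∂ρ, θ ∈ Icc L H)
    (hν : ∀ᵐ θ ∂ν, θ ∈ Icc L H) (hm : m ∈ Icc x (x + 2 * q)) :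
    ∫ θ, shadowPrice m q x θ ∂ρ ≤ ∫ θ, shadowPrice m q x θ ∂ν := by
  rw [integral_shadowPrice hρ, integral_shadowPrice hν, h.mean_eq]
  have h_left := h.integral_ramp_sub_le hρ hν (k := (m - x) / 2) (by linarith [hm.1]) x
  have h_right := h.integral_ramp_le hρ hν (k := (x + 2 * q - m) / 2) (by linarith [hm.2])
    (x + 2 * q)
  linarith

theorem ConvexLE.stopLoss_eq_of_integral_shadowPrice_eq (h : ConvexLE ρ ν)
    (hρ : ∀ᵐ θ ∂ρ, θ ∈ Icc L H) (hν : ∀ᵐ θ ∂ν, θ ∈ Icc L H) (hm : m ∈ Icc x (x + 2 * q))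
    (h_eq : ∫ θ, shadowPrice m q x θ ∂ρ = ∫ θ, shadowPrice m q x θ ∂ν) {t : ℝ}
    (ht : t ∉ Ioo x (x + 2 * q)) : stopLoss ρ t = stopLoss ν t := by
  have hk₁ : 0 ≤ (m - x) / 2 := by linarith [hm.1]
  have hk₂ : 0 ≤ (x + 2 * q - m) / 2 := by linarith [hm.2]
  have h_left := h.integral_ramp_sub_le hρ hν hk₁ x
  have h_right := h.integral_ramp_le hρ hν hk₂ (x + 2 * q)
  rw [integral_shadowPrice hρ, integral_shadowPrice hν, h.mean_eq] at h_eq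
  rcases le_or_gt t x with htx | htx
  · exact h.stopLoss_eq_of_integral_ramp_sub_eq hρ hν hk₁ (by linarith) htx
  · exact h.stopLoss_eq_of_integral_ramp_eq hρ hν hk₂ (by linarith)
      (not_lt.1 fun htx' ↦ ht ⟨htx, htx'⟩)

theorem ConvexLE.measureReal_rays_eq_of_integral_shadowPrice_eq [NullSingletonClass ν]
    (h : ConvexLE ρ ν) (hρ : ∀ᵐ θ ∂ρ, θ ∈ Icc L H) (hν : ∀ᵐ θ ∂ν, θ ∈ Icc L H)
    (hm : m ∈ Icc x (x + 2 * q))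
    (h_eq : ∫ θ, shadowPrice m q x θ ∂ρ = ∫ θ, shadowPrice m q x θ ∂ν) {v : ℝ}
    (hv : v ∉ Ioo x (x + 2 * q)) :
    ρ.real (Iic v) = ν.real (Iic v) ∧ ρ.real (Ici v) = ν.real (Ici v) :=
  h.measureReal_rays_eq_of_stopLoss_eq (integrable_of_continuous hρ continuous_id)
    (integrable_of_continuous hν continuous_id)
    (h.stopLoss_eq_of_integral_shadowPrice_eq hρ hν hm h_eq hv)

end ConvexOrder

/-- The law `ν` after pooling `I` into an atom at `m`. -/
noncomputable def pool (ν : Measure ℝ) (I : Set ℝ) (m : ℝ) : Measure ℝ :=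
  ν.restrict Iᶜ + ν I • Measure.dirac m

section Pool

variable {ν : Measure ℝ} {I : Set ℝ} {m : ℝ}

theorem ae_pool {p : ℝ → Prop} (hI : MeasurableSet I) (hp : ∀ᵐ θ ∂ν, θ ∉ I → p θ) (hm : p m) :
    ∀ᵐ θ ∂pool ν I m, p θ := by
  rw [pool, ae_add_measure_iff]
  refine ⟨(ae_restrict_iff' hI.compl).2 hp, Measure.ae_smul_measure ?_ _⟩
  rwa [ae_dirac_eq]

theorem ae_mem_Icc_pool {L H a b : ℝ} (hν : ∀ᵐ θ ∂ν, θ ∈ Icc L H) (hm : m ∈ Icc L H) :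
    ∀ᵐ θ ∂pool ν (Icc a b) m, θ ∈ Icc L H :=
  ae_pool measurableSet_Icc (hν.mono fun _ hθ _ ↦ hθ) hm

theorem ae_notMem_Ioo_pool {a b : ℝ} : ∀ᵐ θ ∂pool ν (Icc a b) m, θ ∉ Ioo a b ∨ θ = m :=
  ae_pool measurableSet_Icc (.of_forall fun _ hθ ↦ .inl fun h ↦ hθ (Ioo_subset_Icc_self h))
    (.inr rfl)

theorem pool_real_singleton [NullSingletonClass ν] : (pool ν I m).real {m} = ν.real I := by
  have h_null : ν.restrict Iᶜ {m} = 0 := measure_singleton m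
  simp [pool, measureReal_def, h_null]

theorem isProbabilityMeasure_pool [IsProbabilityMeasure ν] (hI : MeasurableSet I) :
    IsProbabilityMeasure (pool ν I m) := by
  constructor
  simp only [pool, Measure.coe_add, Pi.add_apply, Measure.restrict_apply_univ, Measure.coe_smul,
    Pi.smul_apply, measure_univ, smul_eq_mul, mul_one]
  rw [add_comm, prob_add_prob_compl hI]

variable [IsFiniteMeasure ν]

theorem integral_sub_integral_pool (hI : MeasurableSet I) (hν : Integrable (fun θ ↦ θ) ν)
    (hm : ∫ θ in I, (θ - m) ∂ν = 0) {φ : ℝ → ℝ} (hφ : Integrable φ ν) (c : ℝ) :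
    ∫ θ, φ θ ∂ν - ∫ θ, φ θ ∂pool ν I m = ∫ θ in I, (φ θ - (φ m + c * (θ - m))) ∂ν := by
  have h_dirac : Integrable φ (ν I • Measure.dirac m) :=
    (integrable_dirac (by simp)).smul_measure (measure_ne_top _ _)
  have h_sub : IntegrableOn (fun θ ↦ c * (θ - m)) I ν :=
    ((hν.sub (integrable_const m)).const_mul c).integrableOn
  have h_affine : IntegrableOn (fun θ ↦ φ m + c * (θ - m)) I ν := (integrable_const _).add h_sub
  rw [pool, integral_add_measure hφ.integrableOn h_dirac, integral_smul_measure, integral_dirac,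
    ← integral_add_compl hI hφ, integral_sub hφ.integrableOn h_affine,
    integral_add (integrable_const _) h_sub, integral_const_mul, hm, setIntegral_const]
  simp only [smul_eq_mul, measureReal_def]
  ring

theorem integral_pool_eq_of_affineOn (hI : MeasurableSet I) (hν : Integrable (fun θ ↦ θ) ν)
    (hm : ∫ θ in I, (θ - m) ∂ν = 0) {φ : ℝ → ℝ} (hφ : Integrable φ ν) {c : ℝ}
    (hc : ∀ θ ∈ I, φ θ = φ m + c * (θ - m)) : ∫ θ, φ θ ∂pool ν I m = ∫ θ, φ θ ∂ν := by
  have h := integral_sub_integral_pool hI hν hm hφ c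
  rw [setIntegral_eq_zero_of_forall_eq_zero fun θ hθ ↦ sub_eq_zero.2 (hc θ hθ)] at h
  linarith

theorem integral_pool_le_of_affine_le (hI : MeasurableSet I) (hν : Integrable (fun θ ↦ θ) ν)
    (hm : ∫ θ in I, (θ - m) ∂ν = 0) {φ : ℝ → ℝ} (hφ : Integrable φ ν) {c : ℝ}
    (hc : ∀ θ, φ m + c * (θ - m) ≤ φ θ) : ∫ θ, φ θ ∂pool ν I m ≤ ∫ θ, φ θ ∂ν := by
  have h := integral_sub_integral_pool hI hν hm hφ c
  linarith [integral_nonneg (μ := ν.restrict I) fun θ ↦ sub_nonneg.2 (hc θ)]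

theorem convexLE_pool (hI : MeasurableSet I) (hν : Integrable (fun θ ↦ θ) ν)
    (hm : ∫ θ in I, (θ - m) ∂ν = 0) : ConvexLE (pool ν I m) ν where
  mean_eq := integral_pool_eq_of_affineOn hI hν hm hν (c := 1) fun θ _ ↦ by ring
  stopLoss_le t := by
    rcases le_total t m with ht | ht
    · refine integral_pool_le_of_affine_le hI hν hm (integrable_max_sub hν t) (c := 1) fun θ ↦ ?_
      rw [max_eq_left (sub_nonneg.2 ht)]
      linarith [le_max_left (θ - t) 0]
    · refine integral_pool_le_of_affine_le hI hν hm (integrable_max_sub hν t) (c := 0) fun θ ↦ ?_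
      rw [max_eq_right (sub_nonpos.2 ht)]
      linarith [le_max_right (θ - t) 0]

end Pool

section Concentrated

variable {ρ σ : Measure ℝ} {x y m v : ℝ}

theorem measureReal_Iic_eq_of_ae_notMem_Ioo (hρ : ∀ᵐ θ ∂ρ, θ ∉ Ioo x y ∨ θ = m)
    (hv : v ∈ Ico x y) (hvm : v < m) : ρ.real (Iic v) = ρ.real (Iic x) :=
  measureReal_congr <| by
    filter_upwards [hρ] with θ hθ
    change (θ ≤ v) = (θ ≤ x)
    grind

variable [IsProbabilityMeasure ρ]

theorem measureReal_Iic_eq_one_sub_of_ae_notMem_Ioo (hρ : ∀ᵐ θ ∂ρ, θ ∉ Ioo x y ∨ θ = m)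
    (hv : v ∈ Ico x y) (hmv : m ≤ v) : ρ.real (Iic v) = 1 - ρ.real (Ici y) := by
  rw [← probReal_compl_eq_one_sub measurableSet_Ici, compl_Ici]
  refine measureReal_congr ?_
  filter_upwards [hρ] with θ hθ
  change (θ ≤ v) = (θ < y)
  grind

theorem eq_of_ae_notMem_Ioo [IsProbabilityMeasure σ] (hρ : ∀ᵐ θ ∂ρ, θ ∉ Ioo x y ∨ θ = m)
    (hσ : ∀ᵐ θ ∂σ, θ ∉ Ioo x y ∨ θ = m)
    (h_Iic : ∀ v ∉ Ioo x y, ρ.real (Iic v) = σ.real (Iic v))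
    (h_Ici : ρ.real (Ici y) = σ.real (Ici y)) : ρ = σ := by
  refine Measure.eq_of_cdf _ _ (StieltjesFunction.ext fun v ↦ ?_)
  rw [cdf_eq_real, cdf_eq_real]
  by_cases hv : v ∈ Ioo x y
  · rcases lt_or_ge v m with hvm | hvm
    · rw [measureReal_Iic_eq_of_ae_notMem_Ioo hρ (Ioo_subset_Ico_self hv) hvm,
        measureReal_Iic_eq_of_ae_notMem_Ioo hσ (Ioo_subset_Ico_self hv) hvm,
        h_Iic x left_notMem_Ioo]
    · rw [measureReal_Iic_eq_one_sub_of_ae_notMem_Ioo hρ (Ioo_subset_Ico_self hv) hvm,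
        measureReal_Iic_eq_one_sub_of_ae_notMem_Ioo hσ (Ioo_subset_Ico_self hv) hvm, h_Ici]
  · exact h_Iic v hv

end Concentrated

/-- `[x, x + 2 * q]` is an interval around `m` whose conditional mean under `ν` is `m`, encoded
without division so that no mass on the interval is required. -/
structure IsPoolingInterval (ν : Measure ℝ) (m q x : ℝ) : Prop where
  left_lt : x < m
  lt_right : m < x + 2 * q
  setIntegral_sub_eq_zero : ∫ θ in Icc x (x + 2 * q), (θ - m) ∂ν = 0

namespace IsPoolingInterval

variable {ν : Measure ℝ} {m q x : ℝ}

theorem mem_Ioo (h : IsPoolingInterval ν m q x) : m ∈ Ioo x (x + 2 * q) :=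
  ⟨h.left_lt, h.lt_right⟩

variable [IsProbabilityMeasure ν] {L H : ℝ}

theorem integral_shadowPrice_pool (h : IsPoolingInterval ν m q x)
    (hν : ∀ᵐ θ ∂ν, θ ∈ Icc L H) :
    ∫ θ, shadowPrice m q x θ ∂pool ν (Icc x (x + 2 * q)) m = ∫ θ, shadowPrice m q x θ ∂ν := by
  refine integral_pool_eq_of_affineOn measurableSet_Icc
    (integrable_of_continuous hν continuous_id) h.setIntegral_sub_eq_zero
    (integrable_of_continuous hν (continuous_shadowPrice m q x)) (c := (m + x) / 2) fun θ hθ ↦ ?_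
  rw [shadowPrice_of_mem_Icc hθ, shadowPrice_of_mem_Icc (Ioo_subset_Icc_self h.mem_Ioo)]
  ring

theorem integral_onProfit_pool (h : IsPoolingInterval ν m q x) (hν : ∀ᵐ θ ∂ν, θ ∈ Icc L H) :
    ∫ θ, onProfit m q θ ∂pool ν (Icc x (x + 2 * q)) m = ∫ θ, shadowPrice m q x θ ∂ν := by
  rw [← h.integral_shadowPrice_pool hν]
  exact integral_congr_ae (ae_notMem_Ioo_pool.mono fun _ ↦ onProfit_eq_shadowPrice h.mem_Ioo)

protected theorem convexLE_pool (h : IsPoolingInterval ν m q x) (hν : ∀ᵐ θ ∂ν, θ ∈ Icc L H) :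
    ConvexLE (pool ν (Icc x (x + 2 * q)) m) ν :=
  ManagedCampaign.convexLE_pool measurableSet_Icc (integrable_of_continuous hν continuous_id)
    h.setIntegral_sub_eq_zero

theorem integral_eq (h : IsPoolingInterval ν m q x)
    (hν : ∀ᵐ θ ∂ν, θ ∈ Icc L H) (hL : x ≤ L) (hH : H ≤ x + 2 * q) : ∫ θ, θ ∂ν = m := by
  have h_zero := h.setIntegral_sub_eq_zero
  rw [Measure.restrict_eq_self_of_ae_mem (hν.mono fun θ hθ ↦ Icc_subset_Icc hL hH hθ),
    integral_sub (integrable_of_continuous hν continuous_id') (integrable_const _)] at h_zero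
  simpa [sub_eq_zero] using h_zero

variable {ρ : Measure ℝ} [IsProbabilityMeasure ρ]

theorem integral_onProfit_le_pool (h : IsPoolingInterval ν m q x) (hν : ∀ᵐ θ ∂ν, θ ∈ Icc L H)
    (hρ : ∀ᵐ θ ∂ρ, θ ∈ Icc L H) (h_le : ConvexLE ρ ν) :
    ∫ θ, onProfit m q θ ∂ρ ≤ ∫ θ, onProfit m q θ ∂pool ν (Icc x (x + 2 * q)) m := by
  rw [h.integral_onProfit_pool hν]
  exact (integral_onProfit_le_integral_shadowPrice hρ h.mem_Ioo).trans
    (h_le.integral_shadowPrice_le hρ hν (Ioo_subset_Icc_self h.mem_Ioo))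

variable [NullSingletonClass ν]

theorem measureReal_rays_pool (h : IsPoolingInterval ν m q x) (hν : ∀ᵐ θ ∂ν, θ ∈ Icc L H)
    (hm : m ∈ Icc L H) {v : ℝ} (hv : v ∉ Ioo x (x + 2 * q)) :
    (pool ν (Icc x (x + 2 * q)) m).real (Iic v) = ν.real (Iic v) ∧
      (pool ν (Icc x (x + 2 * q)) m).real (Ici v) = ν.real (Ici v) :=
  have := isProbabilityMeasure_pool (ν := ν) (m := m) (measurableSet_Icc (a := x) (b := x + 2 * q))
  (h.convexLE_pool hν).measureReal_rays_eq_of_integral_shadowPrice_eq (ae_mem_Icc_pool hν hm) hν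
    (Ioo_subset_Icc_self h.mem_Ioo) (h.integral_shadowPrice_pool hν) hv

theorem cdf_pool (h : IsPoolingInterval ν m q x) (hν : ∀ᵐ θ ∂ν, θ ∈ Icc L H)
    (hm : m ∈ Icc L H) {v : ℝ} (hv : v ∉ Ioo x (x + 2 * q)) :
    cdf (pool ν (Icc x (x + 2 * q)) m) v = cdf ν v := by
  have := isProbabilityMeasure_pool (ν := ν) (m := m) (measurableSet_Icc (a := x) (b := x + 2 * q))
  rw [cdf_eq_real, cdf_eq_real, (h.measureReal_rays_pool hν hm hv).1]

theorem eq_pool_of_integral_onProfit_le (h : IsPoolingInterval ν m q x)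
    (hν : ∀ᵐ θ ∂ν, θ ∈ Icc L H) (hm : m ∈ Icc L H) (hρ : ∀ᵐ θ ∂ρ, θ ∈ Icc L H)
    (h_le : ConvexLE ρ ν)
    (h_opt : ∫ θ, onProfit m q θ ∂pool ν (Icc x (x + 2 * q)) m ≤ ∫ θ, onProfit m q θ ∂ρ) :
    ρ = pool ν (Icc x (x + 2 * q)) m := by
  have := isProbabilityMeasure_pool (ν := ν) (m := m) (measurableSet_Icc (a := x) (b := x + 2 * q))
  have h_weak := integral_onProfit_le_integral_shadowPrice hρ h.mem_Ioo
  have h_mono := h_le.integral_shadowPrice_le hρ hν (Ioo_subset_Icc_self h.mem_Ioo)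
  rw [h.integral_onProfit_pool hν] at h_opt
  have h_rays {v : ℝ} (hv : v ∉ Ioo x (x + 2 * q)) :=
    h_le.measureReal_rays_eq_of_integral_shadowPrice_eq hρ hν (Ioo_subset_Icc_self h.mem_Ioo)
      (h_mono.antisymm (h_opt.trans h_weak)) hv
  refine eq_of_ae_notMem_Ioo (ae_notMem_Ioo_of_integral_shadowPrice_le hρ h.mem_Ioo
    (h_mono.trans h_opt)) ae_notMem_Ioo_pool (fun v hv ↦ ?_) ?_
  · rw [(h_rays hv).1, (h.measureReal_rays_pool hν hm hv).1]
  · rw [(h_rays right_notMem_Ioo).2, (h.measureReal_rays_pool hν hm right_notMem_Ioo).2]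

end IsPoolingInterval

section FullSupport

variable {ν : Measure ℝ} {L H : ℝ}

theorem ae_mem_Icc_of_support_eq (hν : ν.support = Icc L H) : ∀ᵐ θ ∂ν, θ ∈ Icc L H :=
  hν ▸ Measure.support_mem_ae

variable [IsFiniteMeasure ν]

theorem measureReal_Icc_pos_of_support_eq (hLH : L < H) (hν : ν.support = Icc L H) {a b : ℝ}
    (hab : a < b) (ha : a < H) (hb : L < b) : 0 < ν.real (Icc a b) := by
  obtain ⟨x, h_max, h_min⟩ := exists_between (max_lt (lt_min hab ha) (lt_min hb hLH))
  have hx : x ∈ ν.support := by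
    rw [hν]
    exact ⟨(le_max_right _ _).trans h_max.le, h_min.le.trans (min_le_right _ _)⟩
  exact ENNReal.toReal_pos ((Measure.mem_support_iff_forall x).1 hx _ (Icc_mem_nhds
    ((le_max_left _ _).trans_lt h_max) (h_min.trans_le (min_le_left _ _)))).ne' (measure_ne_top _ _)

end FullSupport

section SetIntegral

variable {ν : Measure ℝ} {m a b : ℝ}

theorem integral_cond_eq_iff [IsFiniteMeasure ν] (hν : Integrable (fun θ ↦ θ) ν)
    (hm : m ≠ 0) (I : Set ℝ) :
    ∫ θ, θ ∂ν[|I] = m ↔ 0 < ν.real I ∧ ∫ θ in I, (θ - m) ∂ν = 0 := by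
  rw [ProbabilityTheory.cond, integral_smul_measure, ENNReal.toReal_inv, ← measureReal_def,
    integral_sub hν.integrableOn (integrable_const _), setIntegral_const, smul_eq_mul, smul_eq_mul]
  rcases measureReal_nonneg (μ := ν) (s := I) |>.eq_or_lt with h | h
  · simp [← h, hm.symm]
  · rw [inv_mul_eq_iff_eq_mul₀ h.ne', sub_eq_zero]
    simp [h]

variable [NullSingletonClass ν]

theorem setIntegral_Icc_eq_intervalIntegral (hab : a ≤ b) (φ : ℝ → ℝ) :
    ∫ θ in Icc a b, φ θ ∂ν = ∫ θ in a..b, φ θ ∂ν := by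
  rw [intervalIntegral.integral_of_le hab, integral_Icc_eq_integral_Ioc]

theorem setIntegral_Icc_pos {f : ℝ → ℝ} (hf : Integrable f ν) (h_pos : ∀ θ ∈ Ioo a b, 0 < f θ)
    (h : 0 < ν.real (Icc a b)) : 0 < ∫ θ in Icc a b, f θ ∂ν := by
  have h_support : Ioo a b ⊆ Function.support f := fun θ hθ ↦ (h_pos θ hθ).ne'
  rw [integral_Icc_eq_integral_Ioo, setIntegral_pos_iff_support_of_nonneg_ae
    ((ae_restrict_iff' measurableSet_Ioo).2 (.of_forall fun θ hθ ↦ (h_pos θ hθ).le))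
    hf.integrableOn, inter_eq_right.2 h_support, measure_congr Ioo_ae_eq_Icc]
  exact (ENNReal.toReal_pos_iff.1 h).1

variable [IsFiniteMeasure ν]

theorem setIntegral_sub_pos (hν : Integrable (fun θ ↦ θ) ν) (ha : m ≤ a)
    (h : 0 < ν.real (Icc a b)) : 0 < ∫ θ in Icc a b, (θ - m) ∂ν :=
  setIntegral_Icc_pos (hν.sub (integrable_const m)) (fun _ hθ ↦ sub_pos.2 (ha.trans_lt hθ.1)) h

theorem setIntegral_sub_neg (hν : Integrable (fun θ ↦ θ) ν) (hb : b ≤ m)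
    (h : 0 < ν.real (Icc a b)) : ∫ θ in Icc a b, (θ - m) ∂ν < 0 := by
  rw [← neg_pos, ← integral_neg]
  exact setIntegral_Icc_pos (hν.sub (integrable_const m)).neg
    (fun _ hθ ↦ neg_pos.2 (sub_neg.2 (hθ.2.trans_le hb))) h

end SetIntegral

section Thresholds

variable {ν : Measure ℝ} [NullSingletonClass ν] [IsFiniteMeasure ν] {L H m q : ℝ}

theorem isPoolingInterval_of_measureReal_pos (hν : Integrable (fun θ ↦ θ) ν) {x : ℝ}
    (h : 0 < ν.real (Icc x (x + 2 * q))) (h_zero : ∫ θ in Icc x (x + 2 * q), (θ - m) ∂ν = 0) :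
    IsPoolingInterval ν m q x where
  left_lt := not_le.1 fun hx ↦ (setIntegral_sub_pos hν hx h).ne' h_zero
  lt_right := not_le.1 fun hx ↦ (setIntegral_sub_neg hν hx h).ne h_zero
  setIntegral_sub_eq_zero := h_zero

theorem continuous_setIntegral_sub (hν : Integrable (fun θ ↦ θ) ν) (hq : 0 ≤ q) :
    Continuous fun x ↦ ∫ θ in Icc x (x + 2 * q), (θ - m) ∂ν := by
  have h_int (a b : ℝ) : IntervalIntegrable (fun θ ↦ θ - m) ν a b :=
    (hν.sub (integrable_const m)).intervalIntegrable
  have h (x : ℝ) : ∫ θ in Icc x (x + 2 * q), (θ - m) ∂ν =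
      (∫ θ in (0 : ℝ)..x + 2 * q, (θ - m) ∂ν) - ∫ θ in (0 : ℝ)..x, (θ - m) ∂ν := by
    rw [setIntegral_Icc_eq_intervalIntegral (by linarith),
      intervalIntegral.integral_interval_sub_left (h_int _ _) (h_int _ _)]
  have h_prim := intervalIntegral.continuous_primitive h_int 0
  simp_rw [h]
  exact (h_prim.comp (continuous_add_const _)).sub h_prim

theorem exists_isPoolingInterval (hν : ν.support = Icc L H) (hm : m ∈ Ioo L H) (hq : 0 < q) :
    ∃ x, IsPoolingInterval ν m q x := by
  have hν' := integrable_of_continuous (ae_mem_Icc_of_support_eq hν) continuous_id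
  have h_pos {x : ℝ} (hx : x ∈ Icc (m - 2 * q) m) : 0 < ν.real (Icc x (x + 2 * q)) :=
    measureReal_Icc_pos_of_support_eq (hm.1.trans hm.2) hν (by linarith) (hx.2.trans_lt hm.2)
      (by linarith [hx.1, hm.1])
  have hq' : m - 2 * q ≤ m := by linarith
  obtain ⟨x, hx, h_zero⟩ := intermediate_value_Icc hq'
    (continuous_setIntegral_sub (m := m) hν' hq.le).continuousOn
    ⟨(setIntegral_sub_neg hν' (by linarith) (h_pos (left_mem_Icc.2 hq'))).le,
      (setIntegral_sub_pos hν' le_rfl (h_pos (right_mem_Icc.2 hq'))).le⟩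
  exact ⟨x, isPoolingInterval_of_measureReal_pos hν' (h_pos hx) h_zero⟩

namespace IsPoolingInterval

variable {y z : ℝ}

theorem setIntegral_sub_eq_shift (hν : Integrable (fun θ ↦ θ) ν) (hy : IsPoolingInterval ν m q y)
    (hz : IsPoolingInterval ν m q z) (hyz : y ≤ z) :
    ∫ θ in Icc y z, (θ - m) ∂ν = ∫ θ in Icc (y + 2 * q) (z + 2 * q), (θ - m) ∂ν := by
  have h_int (a b : ℝ) : IntervalIntegrable (fun θ ↦ θ - m) ν a b :=
    (hν.sub (integrable_const m)).intervalIntegrable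
  have hy_zero := hy.setIntegral_sub_eq_zero
  have hz_zero := hz.setIntegral_sub_eq_zero
  rw [setIntegral_Icc_eq_intervalIntegral (hy.left_lt.trans hy.lt_right).le] at hy_zero
  rw [setIntegral_Icc_eq_intervalIntegral (hz.left_lt.trans hz.lt_right).le] at hz_zero
  rw [setIntegral_Icc_eq_intervalIntegral hyz, setIntegral_Icc_eq_intervalIntegral (by linarith)]
  have h_via_z := intervalIntegral.integral_add_adjacent_intervals (h_int y z) (h_int z (z + 2 * q))
  have h_via_y := intervalIntegral.integral_add_adjacent_intervals (h_int y (y + 2 * q))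
    (h_int (y + 2 * q) (z + 2 * q))
  linarith

theorem le_and_le_of_lt (hν : ν.support = Icc L H) (hm : m ∈ Ioo L H)
    (hy : IsPoolingInterval ν m q y) (hz : IsPoolingInterval ν m q z) (hyz : y < z) :
    z ≤ L ∧ H ≤ y + 2 * q := by
  have hν' := integrable_of_continuous (ae_mem_Icc_of_support_eq hν) continuous_id
  have hLH := hm.1.trans hm.2
  have h_nonpos : ∫ θ in Icc y z, (θ - m) ∂ν ≤ 0 :=
    setIntegral_nonpos measurableSet_Icc fun θ hθ ↦ by linarith [hθ.2, hz.left_lt]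
  have h_nonneg : 0 ≤ ∫ θ in Icc (y + 2 * q) (z + 2 * q), (θ - m) ∂ν :=
    setIntegral_nonneg measurableSet_Icc fun θ hθ ↦ by linarith [hθ.1, hy.lt_right]
  have h_shift := setIntegral_sub_eq_shift hν' hy hz hyz.le
  constructor
  · by_contra! h_lt
    have h_pos := measureReal_Icc_pos_of_support_eq hLH hν hyz (by linarith [hz.left_lt, hm.2]) h_lt
    linarith [setIntegral_sub_neg hν' hz.left_lt.le h_pos]
  · by_contra! h_lt
    have h_pos := measureReal_Icc_pos_of_support_eq hLH hν (add_lt_add_left hyz (2 * q)) h_lt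
      (by linarith [hz.lt_right, hm.1])
    linarith [setIntegral_sub_pos hν' hy.lt_right.le h_pos]

end IsPoolingInterval

theorem integral_cond_eq_iff_isPoolingInterval (hν : ν.support = Icc L H) (hm : m ∈ Ioo L H)
    (hm₀ : m ≠ 0) {x : ℝ} :
    ∫ θ, θ ∂ν[|Icc x (x + 2 * q)] = m ↔ IsPoolingInterval ν m q x := by
  have hν' := integrable_of_continuous (ae_mem_Icc_of_support_eq hν) continuous_id
  rw [integral_cond_eq_iff hν' hm₀]
  refine ⟨fun h ↦ isPoolingInterval_of_measureReal_pos hν' h.1 h.2,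
    fun h ↦ ⟨?_, h.setIntegral_sub_eq_zero⟩⟩
  exact measureReal_Icc_pos_of_support_eq (hm.1.trans hm.2) hν (h.left_lt.trans h.lt_right)
    (h.left_lt.trans hm.2) (hm.1.trans h.lt_right)

end Thresholds

section Uniqueness

variable {ν : Measure ℝ} [NullSingletonClass ν] [IsProbabilityMeasure ν] {L H m q y z : ℝ}

theorem IsPoolingInterval.le (hν : ν.support = Icc L H) (hm : m ∈ Ioo L H)
    (h_mean : ∫ θ, θ ∂ν = m → 2 * q ≤ H - L) (hy : IsPoolingInterval ν m q y)
    (hz : IsPoolingInterval ν m q z) : z ≤ y := by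
  by_contra! hyz
  obtain ⟨hL, hH⟩ := hy.le_and_le_of_lt hν hm hz hyz
  linarith [h_mean (hy.integral_eq (ae_mem_Icc_of_support_eq hν) (hyz.le.trans hL) hH)]

theorem existsUnique_isPoolingInterval (hν : ν.support = Icc L H) (hm : m ∈ Ioo L H)
    (hq : 0 < q) (h_mean : ∫ θ, θ ∂ν = m → 2 * q ≤ H - L) : ∃! x, IsPoolingInterval ν m q x :=
  existsUnique_of_exists_of_unique (exists_isPoolingInterval hν hm hq) fun _ _ hy hz ↦
    (hz.le hν hm h_mean hy).antisymm (hy.le hν hm h_mean hz)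

end Uniqueness

section AtomlessCdf

variable {ν : Measure ℝ} [IsProbabilityMeasure ν] [NullSingletonClass ν]

theorem measureReal_Icc_eq_cdf_sub {a b : ℝ} (hab : a ≤ b) :
    ν.real (Icc a b) = cdf ν b - cdf ν a := by
  rw [measureReal_congr Ioc_ae_eq_Icc.symm, measureReal_def]
  nth_rw 1 [← measure_cdf ν]
  rw [StieltjesFunction.measure_Ioc, ENNReal.toReal_ofReal (sub_nonneg.2 (monotone_cdf ν hab))]

theorem continuous_cdf : Continuous (cdf ν) := by
  refine continuous_iff_continuousAt.2 fun x ↦ ?_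
  rw [(monotone_cdf ν).continuousAt_iff_leftLim_eq_rightLim, StieltjesFunction.rightLim_eq]
  have h_atom : (cdf ν).measure {x} = 0 := by rw [measure_cdf, measure_singleton]
  rw [StieltjesFunction.measure_singleton, ENNReal.ofReal_eq_zero] at h_atom
  exact ((monotone_cdf ν).leftLim_le le_rfl).antisymm (sub_nonpos.1 h_atom)

theorem mem_support_iff_cdf_lt_cdf (x : ℝ) :
    x ∈ ν.support ↔ ∀ a b, a < x → x < b → cdf ν a < cdf ν b := by
  have h_basis := (nhds_basis_Ioo x).mem_measureSupport (μ := ν)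
  refine h_basis.trans ⟨fun h a b ha hb ↦ ?_, fun h i hi ↦ ?_⟩
  · have h_pos := ENNReal.toReal_pos (h (i := (a, b)) ⟨ha, hb⟩).ne' (measure_ne_top _ _)
    rw [← measureReal_def, measureReal_congr Ioo_ae_eq_Icc,
      measureReal_Icc_eq_cdf_sub (ha.trans hb).le] at h_pos
    exact sub_pos.1 h_pos
  · have h_pos := sub_pos.2 (h i.1 i.2 hi.1 hi.2)
    rw [← measureReal_Icc_eq_cdf_sub (hi.1.trans hi.2).le, ← measureReal_congr Ioo_ae_eq_Icc]
      at h_pos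
    exact (ENNReal.toReal_pos_iff.1 h_pos).1

end AtomlessCdf

section HighestValue

variable {P : Measure ℝ} {J : ℕ}

theorem tendsto_powStieltjes_atBot (hJ : J ≠ 0) : Tendsto (powStieltjes P J) atBot (𝓝 0) := by
  simpa only [zero_pow hJ] using! (tendsto_cdf_atBot P).pow J

theorem tendsto_powStieltjes_atTop : Tendsto (powStieltjes P J) atTop (𝓝 1) := by
  simpa only [one_pow] using! (tendsto_cdf_atTop P).pow J

theorem isProbabilityMeasure_highestValueLaw (hJ : J ≠ 0) :
    IsProbabilityMeasure (highestValueLaw P J) :=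
  StieltjesFunction.isProbabilityMeasure _ (tendsto_powStieltjes_atBot hJ)
    tendsto_powStieltjes_atTop

theorem cdf_highestValueLaw (hJ : J ≠ 0) : cdf (highestValueLaw P J) = powStieltjes P J :=
  cdf_measure_stieltjesFunction _ (tendsto_powStieltjes_atBot hJ) tendsto_powStieltjes_atTop

theorem cdf_highestValueLaw_apply (hJ : J ≠ 0) (x : ℝ) :
    cdf (highestValueLaw P J) x = cdf P x ^ J := by
  rw [cdf_highestValueLaw hJ]
  rfl

variable [IsProbabilityMeasure P] [NullSingletonClass P]

theorem nullSingletonClass_highestValueLaw : NullSingletonClass (highestValueLaw P J) where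
  measure_singleton x := by
    have h_cont : Continuous (powStieltjes P J) := continuous_cdf.pow J
    rw [highestValueLaw, StieltjesFunction.measure_singleton,
      h_cont.continuousWithinAt.leftLim_eq, sub_self, ENNReal.ofReal_zero]

theorem support_highestValueLaw (hJ : J ≠ 0) : (highestValueLaw P J).support = P.support := by
  have := isProbabilityMeasure_highestValueLaw (P := P) hJ
  have := nullSingletonClass_highestValueLaw (P := P) (J := J)
  ext x
  simp_rw [mem_support_iff_cdf_lt_cdf, cdf_highestValueLaw_apply hJ,
    pow_lt_pow_iff_left₀ (cdf_nonneg P _) (cdf_nonneg P _) hJ]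

variable {L H : ℝ}

theorem priorMean_mem_Ioo (hLH : L < H) (hP : P.support = Icc L H) :
    priorMean P ∈ Ioo L H := by
  have h_ae := ae_mem_Icc_of_support_eq hP
  have h_int := integrable_of_continuous h_ae continuous_id'
  have h_mass := measureReal_Icc_pos_of_support_eq hLH hP hLH hLH hLH
  have h_sub (m : ℝ) : ∫ θ in Icc L H, (θ - m) ∂P = priorMean P - m := by
    rw [Measure.restrict_eq_self_of_ae_mem h_ae, integral_sub h_int (integrable_const m)]
    simp [priorMean]
  have h_left := setIntegral_sub_pos h_int le_rfl h_mass
  have h_right := setIntegral_sub_neg h_int le_rfl h_mass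
  rw [h_sub] at h_left h_right
  exact ⟨sub_pos.1 h_left, sub_neg.1 h_right⟩

theorem exists_cdf_mem_Ioo (hLH : L < H) (hP : P.support = Icc L H) :
    ∃ c ∈ Icc L H, cdf P c ∈ Ioo 0 1 := by
  obtain ⟨c, hLc, hcH⟩ := exists_between hLH
  have h_mem {x : ℝ} (hx : x ∈ Icc L H) := (mem_support_iff_cdf_lt_cdf x).1 (hP ▸ hx)
  exact ⟨c, ⟨hLc.le, hcH.le⟩,
    (cdf_nonneg P _).trans_lt (h_mem (left_mem_Icc.2 hLH.le) (L - 1) c (sub_one_lt L) hLc),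
    (h_mem (right_mem_Icc.2 hLH.le) c (H + 1) hcH (lt_add_one H)).trans_le (cdf_le_one P _)⟩

theorem integral_cdf_eq_sub_mean {ν : Measure ℝ} [IsProbabilityMeasure ν] (hLH : L ≤ H)
    (hν : ∀ᵐ θ ∂ν, θ ∈ Icc L H) : ∫ t in L..H, cdf ν t = H - ∫ θ, θ ∂ν := by
  have h_int := integrable_of_continuous hν continuous_id
  rw [integral_cdf h_int hLH, stopLoss_eq_zero (hν.mono fun _ hθ ↦ hθ.2),
    stopLoss_eq_mean_sub h_int (hν.mono fun _ hθ ↦ hθ.1)]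
  ring

theorem priorMean_lt_integral_highestValueLaw (hJ : 1 < J) (hLH : L < H)
    (hP : P.support = Icc L H) : priorMean P < ∫ θ, θ ∂highestValueLaw P J := by
  have hJ₀ : J ≠ 0 := by lia
  have := isProbabilityMeasure_highestValueLaw (P := P) hJ₀
  obtain ⟨c, hc, hc_pos, hc_lt_one⟩ := exists_cdf_mem_Ioo hLH hP
  have h_lt : ∫ t in L..H, cdf P t ^ J < ∫ t in L..H, cdf P t :=
    intervalIntegral.integral_lt_integral_of_continuousOn_of_le_of_exists_lt hLH
      (continuous_cdf.pow J).continuousOn continuous_cdf.continuousOn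
      (fun t _ ↦ pow_le_of_le_one (cdf_nonneg _ _) (cdf_le_one _ _) hJ₀)
      ⟨c, hc, pow_lt_self_of_lt_one₀ hc_pos hc_lt_one hJ⟩
  simp_rw [← cdf_highestValueLaw_apply hJ₀] at h_lt
  rw [integral_cdf_eq_sub_mean hLH.le (ae_mem_Icc_of_support_eq hP), integral_cdf_eq_sub_mean hLH.le
    (ae_mem_Icc_of_support_eq ((support_highestValueLaw hJ₀).trans hP))] at h_lt
  exact (sub_lt_sub_iff_left H).1 h_lt

end HighestValue

section Design

variable {P Q : Measure ℝ} {J : ℕ} {L H m lam q : ℝ}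

theorem objective_eq (hQ : ∀ᵐ θ ∂Q, θ ∈ Icc L H) :
    objective L H m lam q Q =
      (1 - lam) * (offPrice m q - q ^ 2 / 2) + lam * ∫ θ, onProfit m q θ ∂Q := by
  rw [objective, Measure.restrict_eq_self_of_ae_mem hQ]

theorem objective_le_objective_iff {Q' : Measure ℝ} (hQ : ∀ᵐ θ ∂Q, θ ∈ Icc L H)
    (hQ' : ∀ᵐ θ ∂Q', θ ∈ Icc L H) (hlam : 0 < lam) :
    objective L H m lam q Q ≤ objective L H m lam q Q' ↔
      ∫ θ, onProfit m q θ ∂Q ≤ ∫ θ, onProfit m q θ ∂Q' := by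
  rw [objective_eq hQ, objective_eq hQ', add_le_add_iff_left, mul_le_mul_iff_right₀ hlam]

variable [IsProbabilityMeasure P] [NullSingletonClass P]

theorem feasible_iff (hJ : J ≠ 0) (hLH : L ≤ H) (hP : P.support = Icc L H) :
    Feasible L H J P Q ↔ IsProbabilityMeasure Q ∧ (∀ᵐ θ ∂Q, θ ∈ Icc L H) ∧
      ConvexLE Q (highestValueLaw P J) := by
  have := isProbabilityMeasure_highestValueLaw (P := P) hJ
  rw [Feasible, ← cdf_highestValueLaw hJ]
  exact and_congr_right fun _ ↦ and_congr_right fun hQ ↦ isMeanPreservingSpread_cdf_iff hLH hQ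
    (ae_mem_Icc_of_support_eq ((support_highestValueLaw hJ).trans hP))

theorem isOptimalDesign_iff_eq_pool (hJ : J ≠ 0) (hP : P.support = Icc L H) (hlam : 0 < lam)
    (hm : priorMean P ∈ Icc L H) {x : ℝ}
    (h : IsPoolingInterval (highestValueLaw P J) (priorMean P) q x) :
    IsOptimalDesign L H J P lam q Q ↔
      Q = pool (highestValueLaw P J) (Icc x (x + 2 * q)) (priorMean P) := by
  have := isProbabilityMeasure_highestValueLaw (P := P) hJ
  have := nullSingletonClass_highestValueLaw (P := P) (J := J)
  have hν := ae_mem_Icc_of_support_eq ((support_highestValueLaw hJ).trans hP)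
  have h_feas {R : Measure ℝ} := feasible_iff (Q := R) hJ (hm.1.trans hm.2) hP
  have h_pool := ae_mem_Icc_pool (a := x) (b := x + 2 * q) hν hm
  have h_pool_feas := h_feas.2 ⟨isProbabilityMeasure_pool measurableSet_Icc, h_pool,
    h.convexLE_pool hν⟩
  constructor
  · rintro ⟨hQ, h_opt⟩
    obtain ⟨_, hQ_ae, hQ_le⟩ := h_feas.1 hQ
    exact h.eq_pool_of_integral_onProfit_le hν hm hQ_ae hQ_le
      ((objective_le_objective_iff h_pool hQ_ae hlam).1 (h_opt _ h_pool_feas))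
  · rintro rfl
    refine ⟨h_pool_feas, fun R hR ↦ ?_⟩
    obtain ⟨_, hR_ae, hR_le⟩ := h_feas.1 hR
    exact (objective_le_objective_iff hR_ae h_pool hlam).2
      (h.integral_onProfit_le_pool hν hR_ae hR_le)

theorem thresholdEquations_iff (hJ : J ≠ 0) (hLH : L < H) (hP : P.support = Icc L H)
    (h_mean : priorMean P ≠ 0) {x₁ x₂ : ℝ} :
    ThresholdEquations J P q x₁ x₂ ↔
      x₁ + 2 * q = x₂ ∧ IsPoolingInterval (highestValueLaw P J) (priorMean P) q x₁ := by
  have := isProbabilityMeasure_highestValueLaw (P := P) hJ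
  have := nullSingletonClass_highestValueLaw (P := P) (J := J)
  refine and_congr_right ?_
  rintro rfl
  exact integral_cond_eq_iff_isPoolingInterval ((support_highestValueLaw hJ).trans hP)
    (priorMean_mem_Ioo hLH hP) h_mean

theorem existsUnique_isPoolingInterval_highestValueLaw (hJ : J ≠ 0) (hLH : L < H)
    (hP : P.support = Icc L H) (hq : 0 < q) (hJq : J = 1 → 2 * q ≤ H - L) :
    ∃! x, IsPoolingInterval (highestValueLaw P J) (priorMean P) q x := by
  have := isProbabilityMeasure_highestValueLaw (P := P) hJ
  have := nullSingletonClass_highestValueLaw (P := P) (J := J)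
  refine existsUnique_isPoolingInterval ((support_highestValueLaw hJ).trans hP)
    (priorMean_mem_Ioo hLH hP) hq fun h_eq ↦ hJq ?_
  by_contra hJ₁
  exact (priorMean_lt_integral_highestValueLaw (by lia) hLH hP).ne' h_eq

theorem pool_highestValueLaw_real_singleton (hJ : J ≠ 0) {a b m : ℝ} (hab : a ≤ b) :
    (pool (highestValueLaw P J) (Icc a b) m).real {m} = cdf P b ^ J - cdf P a ^ J := by
  have := isProbabilityMeasure_highestValueLaw (P := P) hJ
  have := nullSingletonClass_highestValueLaw (P := P) (J := J)
  rw [pool_real_singleton, measureReal_Icc_eq_cdf_sub hab, cdf_highestValueLaw_apply hJ,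
    cdf_highestValueLaw_apply hJ]

end Design

theorem proposition8_general (θL θH : ℝ) (hθ : θL < θH) (P : Measure ℝ) [IsProbabilityMeasure P]
    (hP₀ : ∀ x : ℝ, P {x} = 0) (hP : P.support = Icc θL θH) (hμ : priorMean P ≠ 0)
    (J : ℕ) (hJ : 1 ≤ J) (lam : ℝ) (hlam : 0 < lam)
    (qhat : ℝ) (hq : 0 < qhat) (hJq : J = 1 → 2 * qhat ≤ θH - θL) :
    ∃ x₁ x₂ : ℝ, x₁ ≤ priorMean P ∧ priorMean P ≤ x₂ ∧
      (∀ y₁ y₂ : ℝ, ThresholdEquations J P qhat y₁ y₂ ↔ y₁ = x₁ ∧ y₂ = x₂) ∧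
      ∃ Q : Measure ℝ,
        (∀ R : Measure ℝ, IsOptimalDesign θL θH J P lam qhat R ↔ R = Q) ∧
        EqOn (cdf Q) (fun θ ↦ cdf P θ ^ J) (Iic x₁) ∧
        EqOn (cdf Q) (fun θ ↦ cdf P θ ^ J) (Ici x₂) ∧
        0 < Q.real {priorMean P} ∧ Q.real {priorMean P} = cdf P x₂ ^ J - cdf P x₁ ^ J := by
  have : NullSingletonClass P := ⟨hP₀⟩
  have hJ₀ : J ≠ 0 := by lia
  have := isProbabilityMeasure_highestValueLaw (P := P) hJ₀
  have := nullSingletonClass_highestValueLaw (P := P) (J := J)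
  have hν := (support_highestValueLaw hJ₀).trans hP
  have hm := priorMean_mem_Ioo hθ hP
  have hm' := Ioo_subset_Icc_self hm
  obtain ⟨x, hx, hx_unique⟩ := existsUnique_isPoolingInterval_highestValueLaw hJ₀ hθ hP hq hJq
  have hx_lt : x < x + 2 * qhat := hx.left_lt.trans hx.lt_right
  have h_cdf {v : ℝ} (hv : v ∉ Ioo x (x + 2 * qhat)) :
      cdf (pool (highestValueLaw P J) (Icc x (x + 2 * qhat)) (priorMean P)) v = cdf P v ^ J :=
    (hx.cdf_pool (ae_mem_Icc_of_support_eq hν) hm' hv).trans (cdf_highestValueLaw_apply hJ₀ v)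
  refine ⟨x, x + 2 * qhat, hx.left_lt.le, hx.lt_right.le, fun y₁ y₂ ↦ ?_, _,
    fun R ↦ isOptimalDesign_iff_eq_pool hJ₀ hP hlam hm' hx,
    fun v hv ↦ h_cdf fun h ↦ hv.not_gt h.1, fun v hv ↦ h_cdf fun h ↦ hv.not_gt h.2, ?_,
    pool_highestValueLaw_real_singleton hJ₀ hx_lt.le⟩
  · rw [thresholdEquations_iff hJ₀ hθ hP hμ]
    grind
  · rw [pool_real_singleton]
    exact measureReal_Icc_pos_of_support_eq hθ hν hx_lt (hx.left_lt.trans hm.2)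
      (hm.1.trans hx.lt_right)

end ManagedCampaign

open ManagedCampaign in
theorem proposition8 (θL θH : ℝ) (hθL : 0 ≤ θL) (hθ : θL < θH)
    (P : Measure ℝ) [IsProbabilityMeasure P]
    (hP₀ : ∀ x : ℝ, P {x} = 0) (hP : P.support = Set.Icc θL θH)
    (J : ℕ) (hJ : 1 ≤ J) (lam : ℝ) (hlam₀ : 0 < lam) (hlam₁ : lam ≤ 1)
    (qhat : ℝ) (hq : 0 < qhat) (hJq : J = 1 → 2 * qhat ≤ θH - θL) :
    ∃ x₁ x₂ : ℝ, x₁ ≤ ManagedCampaign.priorMean P ∧ ManagedCampaign.priorMean P ≤ x₂ ∧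
      -- the thresholds are the unique solution of the two equations
      (∀ y₁ y₂ : ℝ, ManagedCampaign.ThresholdEquations J P qhat y₁ y₂ ↔ y₁ = x₁ ∧ y₂ = x₂) ∧
      -- there is exactly one optimal distribution, of the stated form
      ∃ Q : Measure ℝ,
        (∀ R : Measure ℝ, ManagedCampaign.IsOptimalDesign θL θH J P lam qhat R ↔ R = Q) ∧
        Set.EqOn (cdf Q) (fun θ => cdf P θ ^ J) (Set.Iic x₁) ∧
        Set.EqOn (cdf Q) (fun θ => cdf P θ ^ J) (Set.Ici x₂) ∧
        0 < Q.real {ManagedCampaign.priorMean P} ∧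
        Q.real {ManagedCampaign.priorMean P} = cdf P x₂ ^ J - cdf P x₁ ^ J := by
  have : NullSingletonClass P := ⟨hP₀⟩
  exact proposition8_general θL θH hθ P hP₀ hP (hθL.trans_lt (priorMean_mem_Ioo hθ hP).1).ne' J hJ
    lam hlam₀ qhat hq hJq
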